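/- Let $n\ge 0$. A rook of size $n$ is a word $r=r_1\dots r_n$ with letters in $\{0,1,\dots,n\}$ in which every nonzero letter occurs at most once; let $R_n$ be the set of rooks of size $n$. For $0\le i\le n-1$ define a map $\pi_i : R_n\to R_n$, $r\mapsto r\cdot \pi_i$, acting on the right, as follows: $r\cdot\pi_0 = 0\,r_2\dots r_n$, and for $i\ge 1$, $r\cdot\pi_i$ is obtained from $r$ by exchanging $r_i$ and $r_{i+1}$ if $r_i<r_{i+1}$, and $r\cdot\pi_i=r$ otherwise. The $0$-rook monoid $R_n^0$ is the monoid of functions on $R_n$ generated by $\pi_0,\dots,\pi_{n-1}$, with product $r\cdot(fg)=(r\cdot f)\cdot g$. Let $\mathbb{C}[R_n^0]$ be its monoid algebra. **Theorem.** Up to isomorphism, $\mathbb{C}[R_n^0]$ has exactly $2^n$ simple left modules. They are all one-dimensional over $\mathbb{C}$ and are indexed bijectively by the subsets $S\subseteq\{0,\dots,n-1\}$: the simple module $S_S$ associated with $S$ is spanned by a nonzero vector $\varepsilon_S$ on which the generators act by $$\pi_i\cdot\varepsilon_S=\begin{cases}\varepsilon_S & \text{if } i\in S,\\ 0 & \text{otherwise,}\end{cases}\qquad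 0\le i\le n-1.$$ The same holds for simple right modules, with $\varepsilon_S\cdot\pi_i=\varepsilon_S$ if $i\in S$ and $\varepsilon_S\cdot\pi_i=0$ otherwise. -/

import Mathlib

universe u

/-- Rook vectors of size `n`: words `r₁ … rₙ` with letters in `{0, …, n}` in which every nonzero
letter occurs at most once. Such a word is the rook matrix with a `1` in row `rⱼ` of column `j`
whenever `rⱼ ≠ 0`, and no other nonzero entry. Positions are indexed from `0` by `Fin n`. -/
def Rook (n : ℕ) : Type :=
  {r : Fin n → Fin (n + 1) // ∀ i j, r i ≠ 0 → r i = r j → i = j}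

namespace Rook

variable {n : ℕ}

/-- The right action of `P₁`: if `i` is the first position, replace the letter there by `0`. -/
def kill (i : Fin n) (r : Rook n) : Rook n :=
  ⟨Function.update r.1 i 0, by
    intro a b ha hab
    by_cases h1 : a = i
    · exact absurd (by simp [h1]) ha
    · rw [Function.update_of_ne h1] at ha hab
      by_cases h2 : b = i
      · rw [h2, Function.update_self] at hab
        exact absurd hab ha
      · rw [Function.update_of_ne h2] at hab
        exact r.2 a b ha hab⟩

/-- Exchange the letters in positions `i` and `j`. -/
def exchange (i j : Fin n) (r : Rook n) : Rook n :=
  ⟨fun a => r.1 (Equiv.swap i j a), fun _ _ ha hab =>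
    (Equiv.swap i j).injective (r.2 _ _ ha hab)⟩

/-- The operators `r ↦ r · πᵢ` on rooks, `0 ≤ i ≤ n - 1`. The operator `π₀ = P₁` replaces the
first letter by `0`. For `i ≥ 1`, `πᵢ` exchanges the `i`-th and the `(i+1)`-st letters (those in
positions `i - 1` and `i` when counting from `0`) if the former is less than the latter, and fixes
the rook otherwise. -/
def act (i : Fin n) (r : Rook n) : Rook n :=
  if (i : ℕ) = 0 then kill i r
  else
    if r.1 ⟨(i : ℕ) - 1, by omega⟩ < r.1 i then exchange ⟨(i : ℕ) - 1, by omega⟩ i r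
    else r

end Rook

/-- The `0`-rook monoid `Rₙ⁰`: the monoid of functions on rooks generated by `π₀, …, πₙ₋₁`,
where functions act on the right, so that in the product `f * g` the function `f` is applied
first (hence the opposite of the monoid of functions under composition). -/
def zeroRookMonoid (n : ℕ) : Submonoid (Function.End (Rook n))ᵐᵒᵖ :=
  Submonoid.closure (Set.range fun i : Fin n => MulOpposite.op (Rook.act i : Function.End (Rook n)))

/-- The generator `πᵢ` of the `0`-rook monoid, `0 ≤ i ≤ n - 1`. -/
def zeroRookGen {n : ℕ} (i : Fin n) : zeroRookMonoid n :=
  ⟨MulOpposite.op (Rook.act i : Function.End (Rook n)), Submonoid.subset_closure ⟨i, rfl⟩⟩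

/-- The monoid algebra `ℂ[Rₙ⁰]`. -/
abbrev ZeroRookAlgebra (n : ℕ) : Type := MonoidAlgebra ℂ (zeroRookMonoid n)

/-- The generator `πᵢ` as an element of the monoid algebra `ℂ[Rₙ⁰]`. -/
noncomputable def zeroRookAlgGen {n : ℕ} (i : Fin n) : ZeroRookAlgebra n :=
  MonoidAlgebra.of ℂ (zeroRookMonoid n) (zeroRookGen i)

/-- Isomorphism of simple (left) modules over a ring. -/
def simpleModuleSetoid (B : Type) [Ring B] :
    Setoid {M : ModuleCat.{u} B // IsSimpleModule B M} where
  r M N := Nonempty (M.1 ≃ₗ[B] N.1)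
  iseqv :=
    { refl := fun _ => ⟨LinearEquiv.refl _ _⟩
      symm := fun ⟨e⟩ => ⟨e.symm⟩
      trans := fun ⟨e⟩ ⟨f⟩ => ⟨e.trans f⟩ }

/-- The isomorphism classes of simple (left) modules over a ring `B`. Right modules are modules
over `Bᵐᵒᵖ`. -/
def SimpleModuleClass (B : Type) [Ring B] : Type (u + 1) :=
  Quotient (simpleModuleSetoid.{u} B)

/-- The isomorphism class of a simple module. -/
def SimpleModuleClass.mk (B : Type) [Ring B] (V : Type u) [AddCommGroup V] [Module B V]
    [h : IsSimpleModule B V] : SimpleModuleClass.{u} B :=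
  Quotient.mk (simpleModuleSetoid.{u} B) ⟨ModuleCat.of B V, h⟩

/-!
The proof has three ingredients.

*Every simple module contains a common eigenvector of the generators.* A generator that moves a
rook strictly lowers its weight `∑ a, (a + 1) * r a` (`Rook.weight_act_lt`). Summing over all rooks,
`f * πᵢ` is either `f` or has a strictly smaller weight than `f`
(`zeroRookMonoid.mul_gen_eq_or_weight_lt`). Let `V` be simple and let `f` be of minimal weight among
the elements that do not act by zero on `V`. Then `f * πᵢ` is `f` or acts by zero. For a right
module, any nonzero `v · f` is therefore fixed or killed by each `πᵢ`. For a left module, the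
kernel of `f` is a submodule, hence zero, and cancelling `f` shows that each `πᵢ` is the
identity or zero on all of `V`.

*Every assignment of `0` or `1` to the generators extends to a character.* For this it is enough
that the set of generators occurring in a word depends only on the operator it defines. Whether `πᵢ`
occurs is read off from the image of the rook `1 2 … n`: as long as `πᵢ` is not used, the letters
in the positions `≥ i` (counted from `0`) are exactly those greater than `i`; the first use of `πᵢ`
brings a letter `≤ i` there, and no generator can undo this (`Rook.IsCut`, `Rook.IsHigh`).

*A general classification.* If an algebra has generators `pᵢ` with both properties, its simple
modules are the one-dimensional ones given by these characters (`HasZeroOneSimples.bijective_mk`).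
This is applied to `ℂ[Rₙ⁰]` and to its opposite.
-/

/-! ### Algebras whose simple modules are given by `0`-`1` characters -/

section Classification

variable {B : Type} [Ring B] [Algebra ℂ B]

/-- The one-dimensional module on which `b` acts by the scalar `φ b`, in the universe `u`. -/
def CharModule (_φ : B →ₐ[ℂ] ℂ) : Type u := ULift.{u} ℂ

namespace CharModule

variable (φ : B →ₐ[ℂ] ℂ)

noncomputable instance : AddCommGroup (CharModule.{u} φ) :=
  inferInstanceAs (AddCommGroup (ULift.{u} ℂ))

noncomputable instance : Module ℂ (CharModule.{u} φ) :=
  inferInstanceAs (Module ℂ (ULift.{u} ℂ))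

noncomputable instance : Module B (CharModule.{u} φ) :=
  Module.compHom (CharModule.{u} φ) φ.toRingHom

theorem smul_def (b : B) (x : CharModule.{u} φ) : b • x = φ b • x := rfl

instance : IsScalarTower ℂ B (CharModule.{u} φ) where
  smul_assoc c b x := by
    rw [smul_def, smul_def, map_smul, smul_assoc]

/-- The basis vector of `CharModule φ`. -/
def gen : CharModule.{u} φ := ULift.up (1 : ℂ)

theorem gen_ne_zero : gen.{u} φ ≠ 0 := fun h =>
  one_ne_zero (α := ℂ) (congrArg ULift.down h)

theorem exists_smul_gen (x : CharModule.{u} φ) : ∃ c : ℂ, c • gen φ = x :=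
  ⟨x.down, ULift.ext _ _ (mul_one x.down)⟩

instance : IsSimpleModule B (CharModule.{u} φ) := by
  have : Nontrivial (CharModule.{u} φ) := ⟨⟨gen φ, 0, gen_ne_zero φ⟩⟩
  refine isSimpleModule_iff_toSpanSingleton_surjective.mpr ⟨inferInstance, fun x hx y => ?_⟩
  obtain ⟨c, rfl⟩ := exists_smul_gen φ x
  obtain ⟨d, rfl⟩ := exists_smul_gen φ y
  have hc : c ≠ 0 := by
    rintro rfl
    exact hx (zero_smul _ _)
  refine ⟨algebraMap ℂ B (d * c⁻¹), ?_⟩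
  rw [LinearMap.toSpanSingleton_apply, algebraMap_smul, smul_smul, mul_assoc,
    inv_mul_cancel₀ hc, mul_one]

end CharModule

variable {ι : Type} {p : ι → B}

section Eigenvector

variable {V : Type u} [AddCommGroup V] [Module ℂ V] [Module B V] [IsScalarTower ℂ B V]

/-- A nonzero common eigenvector of a generating set spans a simple module over `ℂ`. -/
theorem exists_smul_eq_of_eigenvector [IsSimpleModule B V]
    (hp : Algebra.adjoin ℂ (Set.range p) = ⊤) {v : V} (hv : v ≠ 0)
    (h : ∀ i, ∃ c : ℂ, p i • v = c • v) (x : V) : ∃ c : ℂ, x = c • v := by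
  have key : ∀ b : B, ∃ c : ℂ, b • v = c • v := by
    intro b
    have hb : b ∈ Algebra.adjoin ℂ (Set.range p) := hp ▸ Algebra.mem_top
    induction hb using Algebra.adjoin_induction with
    | mem b hb => obtain ⟨i, rfl⟩ := hb; exact h i
    | algebraMap r => exact ⟨r, algebraMap_smul B r v⟩
    | add a b _ _ ha hb =>
      obtain ⟨c, hc⟩ := ha
      obtain ⟨d, hd⟩ := hb
      exact ⟨c + d, by rw [add_smul, hc, hd, add_smul]⟩
    | mul a b _ _ ha hb =>
      obtain ⟨c, hc⟩ := ha
      obtain ⟨d, hd⟩ := hb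
      refine ⟨d * c, ?_⟩
      rw [mul_smul, hd, ← algebraMap_smul B d v, ← mul_smul, ← Algebra.commutes, mul_smul, hc,
        algebraMap_smul, mul_smul]
  obtain ⟨b, rfl⟩ := IsSimpleModule.toSpanSingleton_surjective B hv x
  exact key b

/-- The action on an eigenvector of the generators determines a simple module: if they act on it by
the values of the character `φ`, then so does the whole algebra. -/
theorem nonempty_linearEquiv_charModule [IsSimpleModule B V] (φ : B →ₐ[ℂ] ℂ)
    (hp : Algebra.adjoin ℂ (Set.range p) = ⊤) {v : V} (hv : v ≠ 0)
    (h : ∀ i, p i • v = φ (p i) • v) : Nonempty (V ≃ₗ[B] CharModule.{u} φ) := by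
  have key : ∀ b : B, b • v = φ b • v := by
    intro b
    have hb : b ∈ Algebra.adjoin ℂ (Set.range p) := hp ▸ Algebra.mem_top
    induction hb using Algebra.adjoin_induction with
    | mem b hb => obtain ⟨i, rfl⟩ := hb; exact h i
    | algebraMap r => rw [algebraMap_smul, AlgHom.commutes]; rfl
    | add a b _ _ ha hb => rw [add_smul, ha, hb, map_add, add_smul]
    | mul a b _ _ ha hb =>
      rw [mul_smul, hb, ← algebraMap_smul B (φ b) v, ← mul_smul, ← Algebra.commutes, mul_smul, ha,
        algebraMap_smul, map_mul, mul_comm, mul_smul]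
  have hspan := exists_smul_eq_of_eigenvector hp hv fun i => ⟨_, h i⟩
  have hsmul : ∀ (b : B) (c : ℂ), (φ b * c) • v = b • c • v := fun b c => by
    rw [mul_smul, ← algebraMap_smul B c v, ← mul_smul b, ← Algebra.commutes, mul_smul, key b,
      algebraMap_smul, algebraMap_smul, smul_comm]
  let g : CharModule.{u} φ →ₗ[B] V :=
    { toFun := fun x => (ULift.down x : ℂ) • v
      map_add' := fun x y => add_smul _ _ _
      map_smul' := fun b x => hsmul b (ULift.down x) }
  have hg : Function.Bijective g := by
    refine ⟨fun x y hxy => ULift.ext _ _ (smul_left_injective ℂ hv hxy), fun y => ?_⟩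
    obtain ⟨c, rfl⟩ := hspan y
    exact ⟨ULift.up c, rfl⟩
  exact ⟨(LinearEquiv.ofBijective g hg).symm⟩

end Eigenvector

variable [DecidableEq ι]

/-- `p` generates the algebra, every assignment of `0` or `1` to the members of `p` extends to
a character, and every simple module contains a nonzero vector that is fixed or killed by each
`p i`. -/
structure HasZeroOneSimples (p : ι → B) (φ : Finset ι → B →ₐ[ℂ] ℂ) : Prop where
  adjoin_eq_top : Algebra.adjoin ℂ (Set.range p) = ⊤
  char_apply : ∀ S i, φ S (p i) = if i ∈ S then 1 else 0
  exists_eigenvector : ∀ (V : Type u) [AddCommGroup V] [Module B V] [IsSimpleModule B V],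
    ∃ v : V, v ≠ 0 ∧ ∀ i, p i • v = v ∨ p i • v = 0

namespace HasZeroOneSimples

variable {φ : Finset ι → B →ₐ[ℂ] ℂ}

theorem smul_gen (H : HasZeroOneSimples.{u} p φ) (S : Finset ι) (i : ι) :
    p i • CharModule.gen.{u} (φ S) = if i ∈ S then CharModule.gen (φ S) else 0 := by
  rw [CharModule.smul_def, H.char_apply]
  split_ifs
  · exact one_smul _ _
  · exact zero_smul _ _

variable [Fintype ι]

theorem bijective_mk (H : HasZeroOneSimples.{u} p φ) : Function.Bijective
    fun S : Finset ι => SimpleModuleClass.mk.{u} B (CharModule.{u} (φ S)) := by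
  constructor
  · intro S T hST
    obtain ⟨f⟩ : Nonempty (CharModule.{u} (φ S) ≃ₗ[B] CharModule.{u} (φ T)) := Quotient.exact hST
    have hne : f (CharModule.gen (φ S)) ≠ 0 := fun h0 =>
      CharModule.gen_ne_zero (φ S) (f.map_eq_zero_iff.mp h0)
    ext i
    have h1 : φ T (p i) • f (CharModule.gen (φ S)) = φ S (p i) • f (CharModule.gen (φ S)) := by
      rw [← CharModule.smul_def, ← map_smul, CharModule.smul_def]
      exact (f.restrictScalars ℂ).map_smul _ _
    have h2 := smul_left_injective ℂ hne h1
    rw [H.char_apply, H.char_apply] at h2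
    by_cases hS : i ∈ S <;> by_cases hT : i ∈ T <;> simp_all
  · intro q
    obtain ⟨⟨V, hV⟩, rfl⟩ := Quotient.exists_rep q
    let : Module ℂ V := Module.compHom V (algebraMap ℂ B)
    have : IsScalarTower ℂ B V := ⟨fun c b x => by
      rw [Algebra.smul_def, mul_smul]; rfl⟩
    obtain ⟨v, hv, hpv⟩ := H.exists_eigenvector V
    classical
    let S : Finset ι := Finset.univ.filter fun i => p i • v = v
    obtain ⟨f⟩ := nonempty_linearEquiv_charModule (φ S) H.adjoin_eq_top hv fun i => by
      rw [H.char_apply]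
      split_ifs with hi
      · rw [one_smul]; exact (Finset.mem_filter.mp hi).2
      · rw [zero_smul]
        exact (hpv i).resolve_left fun h => hi (Finset.mem_filter.mpr ⟨Finset.mem_univ i, h⟩)
    exact ⟨S, Quotient.sound ⟨f.symm⟩⟩

/-- The subset `S` corresponds to the class of the one-dimensional module on which `p i` acts by
`1` if `i ∈ S` and by `0` otherwise. -/
noncomputable def simpleModuleClassEquiv (H : HasZeroOneSimples.{u} p φ) :
    Finset ι ≃ SimpleModuleClass.{u} B :=
  Equiv.ofBijective _ H.bijective_mk

theorem card_simpleModuleClass (H : HasZeroOneSimples.{u} p φ) :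
    Nat.card (SimpleModuleClass.{u} B) = 2 ^ Fintype.card ι := by
  rw [← Nat.card_congr H.simpleModuleClassEquiv, Nat.card_eq_fintype_card, Fintype.card_finset]

theorem finrank_eq_one_and_exists_generator (H : HasZeroOneSimples.{u} p φ) (S : Finset ι)
    (V : Type u) [AddCommGroup V] [Module ℂ V] [Module B V] [IsScalarTower ℂ B V]
    [IsSimpleModule B V] (h : SimpleModuleClass.mk B V = H.simpleModuleClassEquiv S) :
    Module.finrank ℂ V = 1 ∧ ∃ ε : V, ε ≠ 0 ∧ Submodule.span ℂ {ε} = ⊤ ∧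
      ∀ i, p i • ε = if i ∈ S then ε else 0 := by
  obtain ⟨f⟩ : Nonempty (V ≃ₗ[B] CharModule.{u} (φ S)) := Quotient.exact h
  have hne : f.symm (CharModule.gen (φ S)) ≠ 0 := fun h0 =>
    CharModule.gen_ne_zero (φ S) (f.symm.map_eq_zero_iff.mp h0)
  have hp : ∀ i, p i • f.symm (CharModule.gen (φ S)) =
      if i ∈ S then f.symm (CharModule.gen (φ S)) else 0 := fun i => by
    rw [← map_smul, H.smul_gen]
    split_ifs
    · rfl
    · exact map_zero _
  have hspan := exists_smul_eq_of_eigenvector H.adjoin_eq_top hne fun i =>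
    ⟨if i ∈ S then 1 else 0, by rw [hp]; split_ifs <;> simp⟩
  refine ⟨finrank_eq_one _ hne fun x => ?_, _, hne, ?_, hp⟩
  · obtain ⟨c, hc⟩ := hspan x
    exact ⟨c, hc.symm⟩
  · refine eq_top_iff.mpr fun x _ => ?_
    obtain ⟨c, hc⟩ := hspan x
    exact Submodule.mem_span_singleton.mpr ⟨c, hc.symm⟩

end HasZeroOneSimples

end Classification

/-! ### The generators lower the weight of a rook -/

namespace Rook

variable {n : ℕ}

instance : Finite (Rook n) :=
  inferInstanceAs (Finite {r : Fin n → Fin (n + 1) // ∀ i j, r i ≠ 0 → r i = r j → i = j})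

noncomputable instance : Fintype (Rook n) := Fintype.ofFinite _

/-- The weight `∑ a, (a + 1) * r a`. Moving a smaller letter to the right or erasing a letter
lowers it. -/
def weight (r : Rook n) : ℕ := ∑ a : Fin n, ((a : ℕ) + 1) * (r.1 a : ℕ)

theorem act_apply_of_eq_zero {i : Fin n} (hi : (i : ℕ) = 0) (r : Rook n) (a : Fin n) :
    (act i r).1 a = if a = i then 0 else r.1 a := by
  rw [act, if_pos hi]
  exact Function.update_apply _ _ _ _

theorem act_apply_of_lt {i : Fin n} (hi : (i : ℕ) ≠ 0) {r : Rook n}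
    (h : r.1 ⟨(i : ℕ) - 1, by omega⟩ < r.1 i) (a : Fin n) :
    (act i r).1 a = r.1 (Equiv.swap ⟨(i : ℕ) - 1, by omega⟩ i a) := by
  rw [act, if_neg hi, if_pos h]
  rfl

theorem act_of_not_lt {i : Fin n} (hi : (i : ℕ) ≠ 0) {r : Rook n}
    (h : ¬ r.1 ⟨(i : ℕ) - 1, by omega⟩ < r.1 i) : act i r = r := by
  rw [act, if_neg hi, if_neg h]

theorem weight_act_lt (i : Fin n) (r : Rook n) (h : act i r ≠ r) :
    weight (act i r) < weight r := by
  by_cases hi : (i : ℕ) = 0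
  · refine Finset.sum_lt_sum (fun a _ => ?_) ⟨i, Finset.mem_univ _, ?_⟩
    · rw [act_apply_of_eq_zero hi]
      split_ifs
      · simp
      · exact le_rfl
    · rw [act_apply_of_eq_zero hi, if_pos rfl]
      have : r.1 i ≠ 0 := fun h0 => h <| Subtype.ext <| funext fun a => by
        rw [act_apply_of_eq_zero hi]
        split_ifs with ha
        · rw [ha, h0]
        · rfl
      have := Fin.pos_iff_ne_zero.mpr this
      rw [Fin.lt_def] at this
      simp only [Fin.val_zero, mul_zero] at this ⊢
      exact Nat.mul_pos (Nat.succ_pos _) this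
  · by_cases hlt : r.1 ⟨(i : ℕ) - 1, by omega⟩ < r.1 i
    · set j : Fin n := ⟨(i : ℕ) - 1, by omega⟩ with hj
      have hji : j ≠ i := fun e => by
        have := congrArg Fin.val e
        simp only [hj] at this
        omega
      have hmem : j ∈ Finset.univ.erase i := Finset.mem_erase.mpr ⟨hji, Finset.mem_univ _⟩
      unfold weight
      rw [← Finset.add_sum_erase _ _ (Finset.mem_univ i), ← Finset.add_sum_erase _ _ hmem,
        ← Finset.add_sum_erase Finset.univ (fun a : Fin n => ((a : ℕ) + 1) * (r.1 a : ℕ))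
          (Finset.mem_univ i), ← Finset.add_sum_erase _ _ hmem]
      have hrest : ∑ a ∈ (Finset.univ.erase i).erase j, ((a : ℕ) + 1) * ((act i r).1 a : ℕ) =
          ∑ a ∈ (Finset.univ.erase i).erase j, ((a : ℕ) + 1) * (r.1 a : ℕ) := by
        refine Finset.sum_congr rfl fun a ha => ?_
        rw [Finset.mem_erase, Finset.mem_erase] at ha
        rw [act_apply_of_lt hi hlt, Equiv.swap_apply_of_ne_of_ne ha.1 ha.2.1]
      have hai : (act i r).1 i = r.1 j := by
        rw [act_apply_of_lt hi hlt, Equiv.swap_apply_right]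
      have haj : (act i r).1 j = r.1 i := by
        rw [act_apply_of_lt hi hlt, Equiv.swap_apply_left]
      rw [hrest, hai, haj]
      have hij : (i : ℕ) = (j : ℕ) + 1 := by simp only [hj]; omega
      rw [Fin.lt_def] at hlt
      rw [hij]
      nlinarith
    · exact absurd (act_of_not_lt hi hlt) h

/-! ### The generators occurring in a word -/

/-- All letters in the positions `≥ i` are greater than `i`. -/
def IsHigh (i : Fin n) (r : Rook n) : Prop := ∀ a, i ≤ a → (i : ℕ) < r.1 a

/-- The positions `≥ i` hold letters greater than `i`, the positions `< i` letters at most `i`. -/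
def IsCut (i : Fin n) (r : Rook n) : Prop := IsHigh i r ∧ ∀ a, a < i → (r.1 a : ℕ) ≤ i

/-- The rook `1 2 … n`. -/
def one (n : ℕ) : Rook n := ⟨Fin.succ, fun _ _ _ h => Fin.succ_injective _ h⟩

theorem isCut_one (i : Fin n) : IsCut i (one n) := by
  refine ⟨fun a ha => ?_, fun a ha => ?_⟩ <;> simp only [one, Fin.val_succ]
  · rw [Fin.le_def] at ha
    omega
  · rw [Fin.lt_def] at ha
    omega

/-- An adjacent transposition other than that of the positions `i - 1` and `i` preserves the set
of positions `≥ i`. -/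
theorem le_swap_iff {i j : Fin n} (hj : (j : ℕ) ≠ 0) (hij : j ≠ i) (a : Fin n) :
    i ≤ Equiv.swap ⟨(j : ℕ) - 1, by omega⟩ j a ↔ i ≤ a := by
  have hij' : (j : ℕ) ≠ i := fun h => hij (Fin.ext h)
  rw [Equiv.swap_apply_def]
  split_ifs with h1 h2
  · subst h1; simp only [Fin.le_def]; omega
  · subst h2; simp only [Fin.le_def]; omega
  · rfl

theorem IsCut.act {i j : Fin n} (hij : j ≠ i) {r : Rook n} (h : IsCut i r) :
    IsCut i (act j r) := by
  by_cases hj : (j : ℕ) = 0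
  · refine ⟨fun a ha => ?_, fun a ha => ?_⟩
    · have : a ≠ j := by
        rintro rfl
        exact hij (le_antisymm (Fin.le_def.mpr (by omega)) ha)
      rw [act_apply_of_eq_zero hj, if_neg this]
      exact h.1 a ha
    · rw [act_apply_of_eq_zero hj]
      split_ifs
      · exact Nat.zero_le _
      · exact h.2 a ha
  · by_cases hlt : r.1 ⟨(j : ℕ) - 1, by omega⟩ < r.1 j
    · refine ⟨fun a ha => ?_, fun a ha => ?_⟩ <;> rw [act_apply_of_lt hj hlt]
      · exact h.1 _ ((le_swap_iff hj hij a).mpr ha)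
      · refine h.2 _ (not_le.mp fun hle => not_le.mpr ha ((le_swap_iff hj hij a).mp hle))
    · rwa [act_of_not_lt hj hlt]

theorem IsCut.not_isHigh_act {i : Fin n} {r : Rook n} (h : IsCut i r) :
    ¬ IsHigh i (Rook.act i r) := by
  intro hh
  have hi := hh i le_rfl
  by_cases h0 : (i : ℕ) = 0
  · rw [act_apply_of_eq_zero h0, if_pos rfl] at hi
    exact absurd hi (Nat.not_lt_zero _)
  · have hlow : (r.1 ⟨(i : ℕ) - 1, by omega⟩ : ℕ) ≤ i :=
      h.2 _ (by rw [Fin.lt_def]; simp only; omega)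
    have hlt : r.1 ⟨(i : ℕ) - 1, by omega⟩ < r.1 i := by
      rw [Fin.lt_def]
      exact lt_of_le_of_lt hlow (h.1 i le_rfl)
    rw [act_apply_of_lt h0 hlt, Equiv.swap_apply_right] at hi
    omega

theorem IsHigh.of_act {i j : Fin n} {r : Rook n} (h : IsHigh i (act j r)) : IsHigh i r := by
  by_cases hj : (j : ℕ) = 0
  · intro a ha
    have := h a ha
    rw [act_apply_of_eq_zero hj] at this
    split_ifs at this
    · exact absurd this (Nat.not_lt_zero _)
    · exact this
  · by_cases hlt : r.1 ⟨(j : ℕ) - 1, by omega⟩ < r.1 j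
    · by_cases hij : j = i
      · subst hij
        -- The letter moved into position `j` is smaller than the one moved out of it.
        intro a ha
        by_cases hja : a = j
        · subst hja
          have := h a le_rfl
          rw [act_apply_of_lt hj hlt, Equiv.swap_apply_right] at this
          rw [Fin.lt_def] at hlt
          omega
        · have := h a ha
          rwa [act_apply_of_lt hj hlt, Equiv.swap_apply_of_ne_of_ne _ hja] at this
          rintro rfl
          rw [Fin.le_def] at ha
          simp only at ha
          omega
      · intro a ha
        have := h _ ((le_swap_iff hj hij a).mpr ha)
        rwa [act_apply_of_lt hj hlt, Equiv.swap_apply_self] at this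
    · rwa [act_of_not_lt hj hlt] at h

end Rook

namespace zeroRookMonoid

variable {n : ℕ}

/-- The action of an element of the monoid on rooks. -/
def toFun (f : zeroRookMonoid n) (r : Rook n) : Rook n := MulOpposite.unop f.1 r

@[simp] theorem toFun_one (r : Rook n) : toFun 1 r = r := rfl

@[simp] theorem toFun_mul (f g : zeroRookMonoid n) (r : Rook n) :
    toFun (f * g) r = toFun g (toFun f r) := rfl

@[simp] theorem toFun_gen (i : Fin n) (r : Rook n) : toFun (zeroRookGen i) r = Rook.act i r := rfl

theorem toFun_injective : Function.Injective (toFun (n := n)) := fun _ _ h =>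
  Subtype.ext (MulOpposite.unop_injective h)

theorem induction {P : zeroRookMonoid n → Prop} (gen : ∀ i, P (zeroRookGen i)) (one : P 1)
    (mul : ∀ f g, P f → P g → P (f * g)) (f : zeroRookMonoid n) : P f := by
  obtain ⟨f, hf⟩ := f
  induction hf using Submonoid.closure_induction with
  | mem f hf => obtain ⟨i, rfl⟩ := hf; exact gen i
  | one => exact one
  | mul f g hf hg h1 h2 => exact mul ⟨f, hf⟩ ⟨g, hg⟩ h1 h2

theorem isHigh_of_toFun {i : Fin n} (f : zeroRookMonoid n) :
    ∀ r, Rook.IsHigh i (toFun f r) → Rook.IsHigh i r := by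
  induction f using induction with
  | gen j => exact fun r h => h.of_act
  | one => exact fun r h => h
  | mul f g hf hg => exact fun r h => hf r (hg _ h)

/-- The first alternative holds for words that avoid `πᵢ`, the second for words that contain it.
They exclude each other, since the rook `1 2 … n` is cut at `i`. -/
theorem isCut_or_not_isHigh (i : Fin n) (f : zeroRookMonoid n) :
    (∀ r, Rook.IsCut i r → Rook.IsCut i (toFun f r)) ∨
      ∀ r, Rook.IsCut i r → ¬ Rook.IsHigh i (toFun f r) := by
  induction f using induction with
  | gen j =>
    by_cases hij : j = i
    · subst hij
      exact Or.inr fun r h => h.not_isHigh_act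
    · exact Or.inl fun r h => h.act hij
  | one => exact Or.inl fun r h => h
  | mul f g hf hg =>
    rcases hf with hf | hf
    · rcases hg with hg | hg
      · exact Or.inl fun r h => hg _ (hf r h)
      · exact Or.inr fun r h => hg _ (hf r h)
    · exact Or.inr fun r h h' => hf r h (isHigh_of_toFun g _ h')

theorem isHigh_mul_iff (i : Fin n) (f g : zeroRookMonoid n) :
    Rook.IsHigh i (toFun (f * g) (Rook.one n)) ↔
      Rook.IsHigh i (toFun f (Rook.one n)) ∧ Rook.IsHigh i (toFun g (Rook.one n)) := by
  have h1 := Rook.isCut_one i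
  rw [toFun_mul]
  constructor
  · intro h
    have hf := isHigh_of_toFun g _ h
    refine ⟨hf, ?_⟩
    rcases isCut_or_not_isHigh i f with cf | cf
    · rcases isCut_or_not_isHigh i g with cg | cg
      · exact (cg _ h1).1
      · exact absurd h (cg _ (cf _ h1))
    · exact absurd hf (cf _ h1)
  · rintro ⟨hf, hg⟩
    rcases isCut_or_not_isHigh i f with cf | cf
    · rcases isCut_or_not_isHigh i g with cg | cg
      · exact (cg _ (cf _ h1)).1
      · exact absurd hg (cg _ h1)
    · exact absurd hf (cf _ h1)

open Classical in
/-- The character of the monoid sending `πᵢ` to `0` and the other generators to `1`. -/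
noncomputable def avoidChar (i : Fin n) : zeroRookMonoid n →* ℂ where
  toFun f := if Rook.IsHigh i (toFun f (Rook.one n)) then 1 else 0
  map_one' := if_pos (Rook.isCut_one i).1
  map_mul' f g := by
    rw [isHigh_mul_iff]
    split_ifs <;> simp_all

theorem avoidChar_gen (i j : Fin n) : avoidChar i (zeroRookGen j) = if i = j then 0 else 1 := by
  have h1 := Rook.isCut_one i
  by_cases hij : i = j
  · subst hij
    rw [if_pos rfl]
    exact if_neg h1.not_isHigh_act
  · rw [if_neg hij]
    exact if_pos (h1.act (Ne.symm hij)).1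

/-- The character of the monoid sending `πᵢ` to `1` if `i ∈ S` and to `0` otherwise. -/
noncomputable def char (S : Finset (Fin n)) : zeroRookMonoid n →* ℂ :=
  ∏ i ∈ Sᶜ, avoidChar i

theorem char_gen (S : Finset (Fin n)) (j : Fin n) :
    char S (zeroRookGen j) = if j ∈ S then 1 else 0 := by
  rw [char, MonoidHom.finsetProd_apply]
  simp_rw [avoidChar_gen]
  split_ifs with hj
  · refine Finset.prod_eq_one fun i hi => if_neg ?_
    rintro rfl
    exact Finset.mem_compl.mp hi hj
  · exact Finset.prod_eq_zero (Finset.mem_compl.mpr hj) (if_pos rfl)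

/-! ### Absorbing elements of the monoid -/

/-- The sum of the weights of the images of all rooks. -/
noncomputable def weight (f : zeroRookMonoid n) : ℕ := ∑ r, (toFun f r).weight

theorem mul_gen_eq_or_weight_lt (f : zeroRookMonoid n) (i : Fin n) :
    f * zeroRookGen i = f ∨ weight (f * zeroRookGen i) < weight f := by
  by_cases h : ∀ r, Rook.act i (toFun f r) = toFun f r
  · exact Or.inl (toFun_injective (funext h))
  · push Not at h
    obtain ⟨r, hr⟩ := h
    refine Or.inr (Finset.sum_lt_sum (fun s _ => ?_)
      ⟨r, Finset.mem_univ r, Rook.weight_act_lt i _ hr⟩)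
    by_cases hs : Rook.act i (toFun f s) = toFun f s
    · rw [toFun_mul, toFun_gen, hs]
    · exact (Rook.weight_act_lt i _ hs).le

/-- An element of minimal weight with the property `P` absorbs `πᵢ` on the right, unless
multiplying by `πᵢ` destroys `P`. -/
theorem exists_absorbing {P : zeroRookMonoid n → Prop} (h1 : P 1) :
    ∃ f, P f ∧ ∀ i, f * zeroRookGen i = f ∨ ¬ P (f * zeroRookGen i) := by
  obtain ⟨f, hf, hmin⟩ := (measure (weight (n := n))).wf.has_min {f | P f} ⟨1, h1⟩
  exact ⟨f, hf, fun i => (mul_gen_eq_or_weight_lt f i).imp_right fun hlt hP => hmin _ hP hlt⟩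

end zeroRookMonoid

/-! ### Simple modules over the monoid algebra -/

section ZeroRookAlgebra

open zeroRookMonoid

variable {n : ℕ}

theorem adjoin_zeroRookAlgGen :
    Algebra.adjoin ℂ (Set.range (zeroRookAlgGen (n := n))) = ⊤ := by
  refine Algebra.eq_top_iff.mpr fun x => ?_
  induction x using MonoidAlgebra.induction_on with
  | of f =>
    induction f using zeroRookMonoid.induction with
    | gen i => exact Algebra.subset_adjoin ⟨i, rfl⟩
    | one => rw [map_one]; exact one_mem _
    | mul f g hf hg => rw [map_mul]; exact mul_mem hf hg
  | add x y hx hy => exact add_mem hx hy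
  | smul c x hx => exact Subalgebra.smul_mem _ hx c

theorem lift_char_zeroRookAlgGen (S : Finset (Fin n)) (i : Fin n) :
    MonoidAlgebra.lift ℂ ℂ (zeroRookMonoid n) (char S) (zeroRookAlgGen i) =
      if i ∈ S then 1 else 0 := by
  rw [zeroRookAlgGen, MonoidAlgebra.lift_of, char_gen]

/-- In a simple left module every nonzero vector is an eigenvector of all the generators: an
absorbing `f` that does not act by zero acts injectively, and can be cancelled. -/
theorem exists_eigenvector_left (V : Type u) [AddCommGroup V] [Module (ZeroRookAlgebra n) V]
    [IsSimpleModule (ZeroRookAlgebra n) V] :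
    ∃ v : V, v ≠ 0 ∧ ∀ i : Fin n, zeroRookAlgGen i • v = v ∨ zeroRookAlgGen i • v = 0 := by
  have := IsSimpleModule.nontrivial (ZeroRookAlgebra n) V
  obtain ⟨v, hv⟩ := exists_ne (0 : V)
  obtain ⟨f, ⟨w, hw⟩, hf⟩ := exists_absorbing (n := n)
    (P := fun f => ∃ w : V, MonoidAlgebra.of ℂ _ f • w ≠ 0) ⟨v, by rwa [map_one, one_smul]⟩
  have hmul : ∀ i (x : V), MonoidAlgebra.of ℂ _ f • zeroRookAlgGen i • x =
      MonoidAlgebra.of ℂ _ (f * zeroRookGen i) • x := fun i x => by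
    rw [map_mul, mul_smul]; rfl
  have hgen : ∀ i, (∀ x : V, MonoidAlgebra.of ℂ _ f • zeroRookAlgGen i • x =
      MonoidAlgebra.of ℂ _ f • x) ∨
      ∀ x : V, MonoidAlgebra.of ℂ _ f • zeroRookAlgGen i • x = 0 := fun i => by
    rcases hf i with h | h
    · exact Or.inl fun x => by rw [hmul, h]
    · exact Or.inr fun x => by rw [hmul]; exact not_not.mp fun hx => h ⟨x, hx⟩
  -- The vectors killed by `f` form a submodule.
  have hker : ∀ (b : ZeroRookAlgebra n) (x : V), MonoidAlgebra.of ℂ _ f • x = 0 →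
      MonoidAlgebra.of ℂ _ f • b • x = 0 := by
    intro b
    have hb : b ∈ Algebra.adjoin ℂ (Set.range (zeroRookAlgGen (n := n))) :=
      adjoin_zeroRookAlgGen ▸ Algebra.mem_top
    induction hb using Algebra.adjoin_induction with
    | mem b hb =>
      obtain ⟨i, rfl⟩ := hb
      intro x hx
      rcases hgen i with h | h
      · rw [h, hx]
      · exact h x
    | algebraMap r =>
      intro x hx
      rw [← mul_smul, ← Algebra.commutes, mul_smul, hx, smul_zero]
    | add a b _ _ ha hb =>
      intro x hx
      rw [add_smul, smul_add, ha x hx, hb x hx, add_zero]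
    | mul a b _ _ ha hb =>
      intro x hx
      rw [mul_smul]
      exact ha _ (hb x hx)
  let K : Submodule (ZeroRookAlgebra n) V :=
    { carrier := {x | MonoidAlgebra.of ℂ _ f • x = 0}
      zero_mem' := smul_zero _
      add_mem' := fun {x y} hx hy => by
        change _ • (x + y) = 0
        rw [smul_add, hx, hy, add_zero]
      smul_mem' := fun b x hx => hker b x hx }
  have hK : K = ⊥ := (eq_bot_or_eq_top K).resolve_right fun h =>
    hw (h ▸ Submodule.mem_top : w ∈ K)
  have hinj : ∀ x : V, MonoidAlgebra.of ℂ _ f • x = 0 → x = 0 := fun x hx =>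
    (Submodule.mem_bot _).mp (hK ▸ hx : x ∈ (⊥ : Submodule (ZeroRookAlgebra n) V))
  refine ⟨v, hv, fun i => (hgen i).imp (fun h => ?_) fun h => hinj _ (h v)⟩
  exact sub_eq_zero.mp (hinj _ (by rw [smul_sub, h, sub_self]))

/-- In a right module every nonzero vector `v · f`, with `f` absorbing, is an eigenvector of all the
generators. -/
theorem exists_eigenvector_right (V : Type u) [AddCommGroup V] [Module (ZeroRookAlgebra n)ᵐᵒᵖ V]
    [IsSimpleModule (ZeroRookAlgebra n)ᵐᵒᵖ V] :
    ∃ v : V, v ≠ 0 ∧ ∀ i : Fin n, MulOpposite.op (zeroRookAlgGen i) • v = v ∨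
      MulOpposite.op (zeroRookAlgGen i) • v = 0 := by
  have := IsSimpleModule.nontrivial (ZeroRookAlgebra n)ᵐᵒᵖ V
  obtain ⟨v, hv⟩ := exists_ne (0 : V)
  obtain ⟨f, hfv, hf⟩ := exists_absorbing (n := n)
    (P := fun f => MulOpposite.op (MonoidAlgebra.of ℂ _ f) • v ≠ 0)
    (by rwa [map_one, MulOpposite.op_one, one_smul])
  refine ⟨_, hfv, fun i => ?_⟩
  have hmul : MulOpposite.op (zeroRookAlgGen i) • MulOpposite.op (MonoidAlgebra.of ℂ _ f) • v =
      MulOpposite.op (MonoidAlgebra.of ℂ _ (f * zeroRookGen i)) • v := by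
    rw [map_mul, MulOpposite.op_mul, mul_smul]; rfl
  rw [hmul]
  rcases hf i with h | h
  · left; rw [h]
  · right; exact not_not.mp h

theorem hasZeroOneSimples_zeroRookAlgebra (n : ℕ) :
    HasZeroOneSimples.{u} (zeroRookAlgGen (n := n))
      fun S => MonoidAlgebra.lift ℂ ℂ (zeroRookMonoid n) (char S) where
  adjoin_eq_top := adjoin_zeroRookAlgGen
  char_apply := lift_char_zeroRookAlgGen
  exists_eigenvector V := exists_eigenvector_left V

theorem hasZeroOneSimples_zeroRookAlgebra_op (n : ℕ) :
    HasZeroOneSimples.{u} (fun i : Fin n => MulOpposite.op (zeroRookAlgGen i))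
      fun S => (MonoidAlgebra.lift ℂ ℂ (zeroRookMonoid n) (char S)).fromOpposite
        fun _ _ => Commute.all _ _ where
  adjoin_eq_top := by
    refine Algebra.eq_top_iff.mpr fun x => ?_
    obtain ⟨x, rfl⟩ := MulOpposite.op_surjective x
    have hx : x ∈ Algebra.adjoin ℂ (Set.range (zeroRookAlgGen (n := n))) :=
      adjoin_zeroRookAlgGen ▸ Algebra.mem_top
    induction hx using Algebra.adjoin_induction with
    | mem b hb => obtain ⟨i, rfl⟩ := hb; exact Algebra.subset_adjoin ⟨i, rfl⟩
    | algebraMap r => exact Subalgebra.algebraMap_mem _ r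
    | add a b _ _ ha hb => exact add_mem ha hb
    | mul a b _ _ ha hb => exact mul_mem hb ha
  char_apply := lift_char_zeroRookAlgGen
  exists_eigenvector V := exists_eigenvector_right V

end ZeroRookAlgebra

/-- Left modules, then right modules (modules over the opposite algebra): there are `2 ^ n`
isomorphism classes of simple modules, in bijection with the subsets `S` of `{0, …, n - 1}`, and
every module in the class of `S` is one-dimensional, spanned by a vector `ε` with `πᵢ ε = ε` if
`i ∈ S` and `πᵢ ε = 0` otherwise. -/
theorem mainTheorem7 (n : ℕ) :
    (Nat.card (SimpleModuleClass.{u} (ZeroRookAlgebra n)) = 2 ^ n ∧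
      ∃ e : Finset (Fin n) ≃ SimpleModuleClass.{u} (ZeroRookAlgebra n),
        ∀ (S : Finset (Fin n)) (V : Type u) [AddCommGroup V] [Module ℂ V]
          [Module (ZeroRookAlgebra n) V] [IsScalarTower ℂ (ZeroRookAlgebra n) V]
          [IsSimpleModule (ZeroRookAlgebra n) V],
          SimpleModuleClass.mk (ZeroRookAlgebra n) V = e S →
            Module.finrank ℂ V = 1 ∧
              ∃ ε : V, ε ≠ 0 ∧ Submodule.span ℂ {ε} = ⊤ ∧
                ∀ i : Fin n, zeroRookAlgGen i • ε = if i ∈ S then ε else 0) ∧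
    (Nat.card (SimpleModuleClass.{u} (ZeroRookAlgebra n)ᵐᵒᵖ) = 2 ^ n ∧
      ∃ e : Finset (Fin n) ≃ SimpleModuleClass.{u} (ZeroRookAlgebra n)ᵐᵒᵖ,
        ∀ (S : Finset (Fin n)) (V : Type u) [AddCommGroup V] [Module ℂ V]
          [Module (ZeroRookAlgebra n)ᵐᵒᵖ V] [IsScalarTower ℂ (ZeroRookAlgebra n)ᵐᵒᵖ V]
          [IsSimpleModule (ZeroRookAlgebra n)ᵐᵒᵖ V],
          SimpleModuleClass.mk (ZeroRookAlgebra n)ᵐᵒᵖ V = e S →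
            Module.finrank ℂ V = 1 ∧
              ∃ ε : V, ε ≠ 0 ∧ Submodule.span ℂ {ε} = ⊤ ∧
                ∀ i : Fin n, MulOpposite.op (zeroRookAlgGen i) • ε = if i ∈ S then ε else 0) := by
  have H := hasZeroOneSimples_zeroRookAlgebra.{u} n
  have H' := hasZeroOneSimples_zeroRookAlgebra_op.{u} n
  refine ⟨⟨?_, H.simpleModuleClassEquiv, fun S V _ _ _ _ _ h =>
      H.finrank_eq_one_and_exists_generator S V h⟩,
    ⟨?_, H'.simpleModuleClassEquiv, fun S V _ _ _ _ _ h =>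
      H'.finrank_eq_one_and_exists_generator S V h⟩⟩
  · rw [H.card_simpleModuleClass, Fintype.card_fin]
  · rw [H'.card_simpleModuleClass, Fintype.card_fin]
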